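/- Let $\Sigma$ be an arbitrary group. A difference ring is a commutative ring with identity on which $\Sigma$ acts by ring automorphisms; a difference field is a difference ring that is a field; a difference homomorphism is a ring homomorphism that commutes with the action of $\Sigma$. A difference ideal of a difference ring $A$ is an ideal $I$ with $\sigma(I)\subseteq I$ for all $\sigma\in\Sigma$. It is perfect if, for every $a\in A$, all $\sigma_1,\dots,\sigma_s\in\Sigma$ and all integers $k_1,\dots,k_s\ge 0$, $\sigma_1(a)^{k_1}\cdots\sigma_s(a)^{k_s}\in I$ implies $a\in I$. The ring of difference polynomials $A\{y_1,\dots,y_n\}$ is the polynomial ring over $A$ in the indeterminates $\sigma y_i$ ($\sigma\in\Sigma$, $1\le i\le n$), on which $\tau\in\Sigma$ acts through its action on the coefficients and by $\tau(\sigma y_i)=(\tau\sigma)y_i$. The value of a difference polynomial at $(x_1,\dots,x_n)\in A^n$ is obtained by substituting $\sigma(x_i)$ for $\sigma y_i$. A difference field $L$ is called differencly closed if for every natural number $n$ every proper perfect difference ideal of $L\{y_1,\dots,y_n\}$ has a common zero in $L^n$. Theorem. For every group $\Sigma$, every difference field $K$ can be embedded into a differencly closed field, i.e. there are a differencly closed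 difference field $L$ (with the same group $\Sigma$) and an injective difference homomorphism $K\to L$. -/

import Mathlib

universe u v

/-! A difference ring is a commutative ring `A` with an action of a group `G` by ring
automorphisms, that is, `[CommRing A] [MulSemiringAction G A]`. A difference field is a field with
such an action, and a difference homomorphism `A → B` is a `A →+*[G] B`. -/

/-- A difference ideal is an ideal that is stable under the action of `G`. -/
def IsDifferenceIdeal (G : Type*) {A : Type*} [Group G] [CommRing A] [MulSemiringAction G A]
    (I : Ideal A) : Prop :=
  ∀ (g : G) (a : A), a ∈ I → g • a ∈ I

/-- A difference ideal `I` is perfect if `a ∈ I` whenever some product of powers of translates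
`∏ g ∈ s, (g • a) ^ k g` of `a` lies in `I`. -/
def IsPerfectDifferenceIdeal (G : Type*) {A : Type*} [Group G] [CommRing A]
    [MulSemiringAction G A] (I : Ideal A) : Prop :=
  IsDifferenceIdeal G I ∧
    ∀ (a : A) (s : Finset G) (k : G → ℕ), ∏ g ∈ s, (g • a) ^ k g ∈ I → a ∈ I

/-- The ring of difference polynomials `A{Y}`, where `Y = {y_i | i ∈ ι}`: the polynomial ring over
`A` in the indeterminates `g y_i`, for `g ∈ G` and `i ∈ ι`. It is a new type, and not an
abbreviation, because the action of `G` that Mathlib puts on `MvPolynomial (G × ι) A` moves only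
the coefficients. -/
def DifferencePolynomial (G ι A : Type*) [CommRing A] : Type _ :=
  MvPolynomial (G × ι) A

namespace DifferencePolynomial

variable (G ι : Type*) {A : Type*} [Group G] [CommRing A] [MulSemiringAction G A]

noncomputable instance : CommRing (DifferencePolynomial G ι A) :=
  inferInstanceAs (CommRing (MvPolynomial (G × ι) A))

/-- The action of `g` on `A{Y}`: it acts on the coefficients as it does on `A`, and it sends the
indeterminate `h y_i` to `(g h) y_i`. -/
noncomputable def shift (g : G) : MvPolynomial (G × ι) A →+* MvPolynomial (G × ι) A :=
  MvPolynomial.eval₂Hom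
    ((MvPolynomial.C : A →+* MvPolynomial (G × ι) A).comp (MulSemiringAction.toRingHom G A g))
    (fun p => MvPolynomial.X (g * p.1, p.2))

theorem shift_one : shift G ι (A := A) (1 : G) = RingHom.id _ := by
  unfold shift
  apply MvPolynomial.ringHom_ext
  · intro a; simp
  · intro p; simp

theorem shift_mul (g h : G) :
    shift G ι (A := A) (g * h) = (shift G ι g).comp (shift G ι h) := by
  unfold shift
  apply MvPolynomial.ringHom_ext
  · intro a; simp [mul_smul]
  · intro p; simp [mul_assoc]

noncomputable instance : MulSemiringAction G (DifferencePolynomial G ι A) where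
  smul g f := shift G ι g f
  one_smul f := congrArg (fun φ => φ f) (shift_one G ι (A := A))
  mul_smul g h f := congrArg (fun φ => φ f) (shift_mul G ι (A := A) g h)
  smul_zero g := map_zero (shift G ι g)
  smul_add g := map_add (shift G ι g)
  smul_one g := map_one (shift G ι g)
  smul_mul g := map_mul (shift G ι g)

variable {G ι}

/-- The substitution homomorphism `f ↦ f(x)` at a point `x` of `A^Y`: the indeterminate `g y_i`
is replaced by `g • x i`. -/
noncomputable def eval (x : ι → A) : DifferencePolynomial G ι A →+* A :=
  (MvPolynomial.eval (fun p : G × ι => p.1 • x p.2) : MvPolynomial (G × ι) A →+* A)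

end DifferencePolynomial

/-- A difference field `K` is differencly closed if for every natural number `n` every proper
perfect difference ideal of `K{y_1, …, y_n}` has a common zero in `K^n`. -/
def IsDifferenclyClosed (G K : Type*) [Group G] [Field K] [MulSemiringAction G K] : Prop :=
  ∀ (n : ℕ) (I : Ideal (DifferencePolynomial G (Fin n) K)),
    IsPerfectDifferenceIdeal G I → I ≠ ⊤ →
      ∃ x : Fin n → K, ∀ f ∈ I, DifferencePolynomial.eval x f = 0

/-!
The differencly closed field is made by a construction of Henkin type, which takes the place of a
transfinite tower of extensions.

A proper perfect difference ideal that is maximal among such ideals is prime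
(`IsPerfectDifferenceIdeal.exists_le_prime`), so every proper perfect ideal of `L{y_1, …, y_n}` lies
in an invariant prime ideal `Q`, and the fraction field of `L{y_1, …, y_n} / Q` is an extension of
`L` in which `Q` has a zero. The task is to find `L` such that this zero can be chosen in `L`.

The ideal `Q` need not be finitely generated as a difference ideal, but it has a family of
generators whose index set `Finset (G × Fin n) × ℕ` depends only on `G` and `n`, by Hilbert's basis
theorem (`MvPolynomial.exists_span_range_eq`). Hence there is an inductive type `Witness G K` that
has a tuple of witnesses, a designated solution, for every system of this size whose coefficients
are witnesses. Let `R` be the ring of difference polynomials over `K` in the witnesses. A system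
precedes those in which its designated solution occurs; this relation is well-founded and extends
to a well-order. Going through the systems in this order, retain a system if its relations,
together with those retained before, lie in a proper perfect ideal of `R`. By compactness, the union
of all retained relations lies in a proper perfect ideal (`exists_greedy_isConsistent`), hence in an
invariant prime ideal `P`. Let `L` be the fraction field of `R / P`.

To see that `L` is differencly closed, clear the denominators of the generators of `Q`
(`DifferencePolynomial.exists_lift_eq_const_mul`), so that they come from a system `s`. Let `E` be
the fraction field of `L{y_1, …, y_n} / Q`, and change the homomorphism `R → L → E` so that it sends
the witnesses of `s` to the zero of `Q` in `E`. None of the relations of earlier systems involves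
these witnesses, and neither do the coefficients of `s`, so the new homomorphism kills the relations
of `s` and those retained before. Its kernel is a proper perfect ideal, whence `s` is retained, and
the images in `L` of the witnesses of `s` are a zero of `Q`.
-/

/-! ### Perfect difference ideals -/

section Perfect

variable {G : Type*} {A : Type*} [Group G] [CommRing A] [MulSemiringAction G A]

namespace IsPerfectDifferenceIdeal

/-- One more factor may be adjoined to the product in the definition of a perfect ideal, even if
the group element occurs in the product already. -/
theorem mem_of_prod_mul_mem {I : Ideal A} (hI : IsPerfectDifferenceIdeal G I) (a : A)
    (s : Finset G) (k : G → ℕ) (h : G)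
    (H : (∏ g ∈ s, (g • a) ^ k g) * h • a ∈ I) : a ∈ I := by
  classical
  refine hI.2 a (insert h s) (fun g => (if g ∈ s then k g else 0) + if g = h then 1 else 0) ?_
  have e : ∏ g ∈ insert h s, (g • a) ^ ((if g ∈ s then k g else 0) + if g = h then 1 else 0)
      = (∏ g ∈ s, (g • a) ^ k g) * h • a := by
    simp only [pow_add, Finset.prod_mul_distrib]
    congr 1
    · rw [← Finset.prod_subset (Finset.subset_insert h s)]
      · exact Finset.prod_congr rfl fun g hg => by rw [if_pos hg]
      · intro g _ hg
        rw [if_neg hg, pow_zero]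
    · rw [Finset.prod_eq_single_of_mem h (Finset.mem_insert_self h s)]
      · simp
      · intro g _ hg
        rw [if_neg hg, pow_zero]
  rwa [e]

theorem colon {I : Ideal A} (hI : IsPerfectDifferenceIdeal G I) (b : A) :
    IsPerfectDifferenceIdeal G (Submodule.colon I {b}) := by
  refine ⟨fun g a ha => ?_, fun a s k ha => ?_⟩
  · rw [Submodule.mem_colon_singleton, smul_eq_mul] at ha ⊢
    -- `c = g(a) b` satisfies `c · g⁻¹(c) = a b · g(a) g⁻¹(b)`.
    refine hI.mem_of_prod_mul_mem (g • a * b) {1} (fun _ => 1) g⁻¹ ?_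
    have e : (∏ h ∈ ({1} : Finset G), (h • (g • a * b)) ^ 1) * g⁻¹ • (g • a * b)
        = (g • a * g⁻¹ • b) * (a * b) := by
      simp only [Finset.prod_singleton, one_smul, pow_one, smul_mul', inv_smul_smul]
      ring
    rw [e]
    exact I.mul_mem_left _ ha
  · rw [Submodule.mem_colon_singleton, smul_eq_mul] at ha ⊢
    refine hI.mem_of_prod_mul_mem (a * b) s k 1 ?_
    have e : (∏ g ∈ s, (g • (a * b)) ^ k g) * (1 : G) • (a * b)
        = ((∏ g ∈ s, (g • b) ^ k g) * a) * ((∏ g ∈ s, (g • a) ^ k g) * b) := by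
      simp only [smul_mul', mul_pow, Finset.prod_mul_distrib, one_smul]
      ring
    rw [e]
    exact I.mul_mem_left _ ha

theorem sInf {S : Set (Ideal A)} (hS : ∀ I ∈ S, IsPerfectDifferenceIdeal G I) :
    IsPerfectDifferenceIdeal G (sInf S) := by
  refine ⟨fun g a ha => ?_, fun a s k ha => ?_⟩
  · rw [Submodule.mem_sInf] at ha ⊢
    exact fun I hI => (hS I hI).1 g a (ha I hI)
  · rw [Submodule.mem_sInf] at ha ⊢
    exact fun I hI => (hS I hI).2 a s k (ha I hI)

theorem iSup_of_directed {ι : Type*} [Nonempty ι] {S : ι → Ideal A} (hd : Directed (· ≤ ·) S)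
    (hS : ∀ i, IsPerfectDifferenceIdeal G (S i)) : IsPerfectDifferenceIdeal G (⨆ i, S i) := by
  refine ⟨fun g a ha => ?_, fun a s k ha => ?_⟩
  · rw [Submodule.mem_iSup_of_directed S hd] at ha ⊢
    exact ha.imp fun i hi => (hS i).1 g a hi
  · rw [Submodule.mem_iSup_of_directed S hd] at ha ⊢
    exact ha.imp fun i hi => (hS i).2 a s k hi

/-- A maximal proper perfect difference ideal is prime: if `a b ∈ M` and `b ∉ M`, then the ideal
quotient `(M : b)` is a proper perfect ideal that contains `M`, so it is `M`. -/
theorem exists_le_prime {I : Ideal A} (hI : IsPerfectDifferenceIdeal G I) (hne : I ≠ ⊤) :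
    ∃ P : Ideal A, P.IsPrime ∧ IsDifferenceIdeal G P ∧ I ≤ P := by
  obtain ⟨M, hIM, hM⟩ := zorn_le_nonempty₀ {J : Ideal A | IsPerfectDifferenceIdeal G J ∧ J ≠ ⊤}
    (by
      intro c hc hchain J hJ
      have : Nonempty c := ⟨⟨J, hJ⟩⟩
      have hd : Directed (· ≤ ·) (fun i : c => (i : Ideal A)) := hchain.directedOn.directed_val
      refine ⟨⨆ i : c, (i : Ideal A), ⟨iSup_of_directed hd fun i => (hc i.2).1, ?_⟩,
        fun z hz => le_iSup (fun i : c => (i : Ideal A)) ⟨z, hz⟩⟩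
      rw [Ne, Ideal.eq_top_iff_one, Submodule.mem_iSup_of_directed _ hd]
      rintro ⟨i, hi⟩
      exact (hc i.2).2 ((Ideal.eq_top_iff_one _).2 hi)) I ⟨hI, hne⟩
  refine ⟨M, ⟨hM.prop.2, fun {a b} hab => ?_⟩, hM.prop.1.1, hIM⟩
  by_cases hb : b ∈ M
  · exact Or.inr hb
  refine Or.inl (hM.le_of_ge (y := Submodule.colon M {b}) ⟨hM.prop.1.colon b, ?_⟩ ?_ ?_)
  · rw [Ne, Ideal.eq_top_iff_one, Submodule.mem_colon_singleton, one_smul]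
    exact hb
  · intro x hx
    rw [Submodule.mem_colon_singleton, smul_eq_mul]
    exact M.mul_mem_right _ hx
  · rwa [Submodule.mem_colon_singleton, smul_eq_mul]

end IsPerfectDifferenceIdeal

theorem isPerfectDifferenceIdeal_ker {E : Type*} [Field E] [MulSemiringAction G E]
    (θ : A →+*[G] E) : IsPerfectDifferenceIdeal G (RingHom.ker (θ : A →+* E)) := by
  refine ⟨fun g a ha => ?_, fun a s k ha => ?_⟩
  · have ha' : θ a = 0 := ha
    change θ (g • a) = 0
    rw [map_smul, ha', smul_zero]
  · have ha' : θ (∏ g ∈ s, (g • a) ^ k g) = 0 := ha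
    rw [map_prod, Finset.prod_eq_zero_iff] at ha'
    obtain ⟨g, -, hg⟩ := ha'
    rw [map_pow] at hg
    have hg' := eq_zero_of_pow_eq_zero hg
    rw [map_smul, smul_eq_zero_iff_eq] at hg'
    exact hg'

variable (G) in
/-- A set of elements of a difference ring is consistent if it lies in a proper perfect difference
ideal. -/
def IsConsistent (X : Set A) : Prop :=
  ∃ I : Ideal A, IsPerfectDifferenceIdeal G I ∧ I ≠ ⊤ ∧ X ⊆ I

theorem IsConsistent.mono {X Y : Set A} (hY : IsConsistent G Y) (h : X ⊆ Y) :
    IsConsistent G X :=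
  let ⟨I, hI, hne, hYI⟩ := hY
  ⟨I, hI, hne, h.trans hYI⟩

theorem isConsistent_of_hom {E : Type*} [Field E] [MulSemiringAction G E] (θ : A →+*[G] E)
    {X : Set A} (hX : ∀ a ∈ X, θ a = 0) : IsConsistent G X := by
  refine ⟨RingHom.ker (θ : A →+* E), isPerfectDifferenceIdeal_ker θ, RingHom.ker_ne_top _, hX⟩

/-- Compactness: the perfect ideals generated by the finite subsets of `X` form a directed family,
whose union is a perfect ideal. -/
theorem isConsistent_of_finite {X : Set A}
    (hX : ∀ Y : Finset A, (Y : Set A) ⊆ X → IsConsistent G (Y : Set A)) : IsConsistent G X := by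
  classical
  let cl : {Y : Finset A // (Y : Set A) ⊆ X} → Ideal A := fun Y =>
    InfSet.sInf {I : Ideal A | IsPerfectDifferenceIdeal G I ∧ (Y.1 : Set A) ⊆ I}
  have hmono : ∀ Y Z : {Y : Finset A // (Y : Set A) ⊆ X}, Y.1 ⊆ Z.1 → cl Y ≤ cl Z :=
    fun Y Z h => sInf_le_sInf fun I hI => ⟨hI.1, (Finset.coe_subset.2 h).trans hI.2⟩
  have : Nonempty {Y : Finset A // (Y : Set A) ⊆ X} := ⟨⟨∅, by simp⟩⟩
  have hd : Directed (· ≤ ·) cl := fun Y Z =>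
    ⟨⟨Y.1 ∪ Z.1, by rw [Finset.coe_union]; exact Set.union_subset Y.2 Z.2⟩,
      hmono _ _ Finset.subset_union_left, hmono _ _ Finset.subset_union_right⟩
  refine ⟨⨆ Y, cl Y, .iSup_of_directed hd fun Y => .sInf fun I hI => hI.1, ?_, fun x hx => ?_⟩
  · rw [Ne, Ideal.eq_top_iff_one, Submodule.mem_iSup_of_directed _ hd]
    rintro ⟨Y, hY⟩
    obtain ⟨I, hI, hne, hYI⟩ := hX Y.1 Y.2
    exact hne ((Ideal.eq_top_iff_one _).2 ((sInf_le (α := Ideal A) ⟨hI, hYI⟩ : cl Y ≤ I) hY))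
  · have hY : (({x} : Finset A) : Set A) ⊆ X := by simpa using hx
    refine Submodule.mem_iSup_of_mem ⟨{x}, hY⟩ ((Submodule.mem_sInf).2 fun I hI => ?_)
    exact hI.2 (by simp)

/-- Go through the sets `F t` in the given well-order, and retain each one that is consistent with
those retained before it. The union of the retained sets is consistent, because any finite part of
it lies in the union over `t' ≤ t` for some retained `t`, and that union is consistent by the
choice of `t`. -/
theorem exists_greedy_isConsistent (h0 : IsConsistent G (∅ : Set A)) {α : Type*}
    (r : α → α → Prop) [IsWellOrder α r] (F : α → Set A) :
    ∃ T : Set α, IsConsistent G (⋃ t ∈ T, F t) ∧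
      ∀ s, IsConsistent G (F s ∪ ⋃ t ∈ {t ∈ T | r t s}, F t) → s ∈ T := by
  classical
  have wf : WellFounded r := IsWellFounded.wf
  let p : α → Prop := wf.fix fun s ih =>
    IsConsistent G (F s ∪ ⋃ t ∈ {t | ∃ h : r t s, ih t h}, F t)
  have hp : ∀ s, p s ↔ IsConsistent G (F s ∪ ⋃ t ∈ {t ∈ {t | p t} | r t s}, F t) := by
    intro s
    have e := wf.fix_eq (fun s (ih : ∀ t, r t s → Prop) =>
      IsConsistent G (F s ∪ ⋃ t ∈ {t | ∃ h : r t s, ih t h}, F t)) s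
    change p s = _ at e
    rw [e]
    have : {t | ∃ _ : r t s, p t} = {t ∈ {t | p t} | r t s} := by
      ext t
      simp [and_comm]
    rw [← this]
  refine ⟨{t | p t}, isConsistent_of_finite fun Y hY => ?_, fun s hs => (hp s).2 hs⟩
  suffices H : Y = ∅ ∨ ∃ s, p s ∧ (Y : Set A) ⊆ F s ∪ ⋃ t ∈ {t ∈ {t | p t} | r t s}, F t by
    obtain rfl | ⟨s, hs, hYs⟩ := H
    · simpa using h0
    · exact ((hp s).1 hs).mono hYs
  induction Y using Finset.induction_on with
  | empty => exact Or.inl rfl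
  | insert y Y _ ih =>
    rw [Finset.coe_insert, Set.insert_subset_iff] at hY
    obtain ⟨t, ht, hyt⟩ := Set.mem_iUnion₂.1 hY.1
    rw [Finset.coe_insert]
    right
    obtain rfl | ⟨s, hs, hYs⟩ := ih hY.2
    · exact ⟨t, ht, by simpa using Or.inl hyt⟩
    rcases trichotomous_of r s t with hst | rfl | hts
    · refine ⟨t, ht, Set.insert_subset (Or.inl hyt) fun z hz => Or.inr ?_⟩
      rcases hYs hz with h | h
      · exact Set.mem_biUnion (show s ∈ {t' ∈ {t' | p t'} | r t' t} from ⟨hs, hst⟩) h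
      · obtain ⟨q, hq, hzq⟩ := Set.mem_iUnion₂.1 h
        exact Set.mem_biUnion (show q ∈ {t' ∈ {t' | p t'} | r t' t} from
          ⟨hq.1, trans_of r hq.2 hst⟩) hzq
    · exact ⟨s, hs, Set.insert_subset (Or.inl hyt) hYs⟩
    · exact ⟨s, hs, Set.insert_subset (Or.inr (Set.mem_biUnion
        (show t ∈ {t' ∈ {t' | p t'} | r t' s} from ⟨ht, hts⟩) hyt)) hYs⟩

end Perfect

/-! ### Homomorphisms from rings of difference polynomials -/

namespace DifferencePolynomial

variable {G ι κ A B : Type*} [Group G] [CommRing A] [MulSemiringAction G A]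
  [CommRing B] [MulSemiringAction G B]

variable (G ι A) in
/-- The embedding of the coefficients. -/
noncomputable def const : A →+*[G] DifferencePolynomial G ι A where
  __ := (MvPolynomial.C : A →+* MvPolynomial (G × ι) A)
  map_smul' g a := by
    change MvPolynomial.C (g • a) = shift G ι g (MvPolynomial.C a)
    simp [shift]

variable (G A) in
/-- The indeterminate `y_i`. -/
noncomputable def var (i : ι) : DifferencePolynomial G ι A :=
  (MvPolynomial.X (1, i) : MvPolynomial (G × ι) A)

theorem smul_var (g : G) (i : ι) :
    g • var G A i = (MvPolynomial.X (g, i) : MvPolynomial (G × ι) A) := by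
  change shift G ι g (MvPolynomial.X (1, i)) = _
  simp [shift]

theorem induction_on {p : DifferencePolynomial G ι A → Prop} (f : DifferencePolynomial G ι A)
    (hc : ∀ a, p (const G ι A a)) (ha : ∀ f h, p f → p h → p (f + h))
    (hv : ∀ f (g : G) i, p f → p (f * g • var G A i)) : p f :=
  MvPolynomial.induction_on (motive := p) f hc ha fun f x hf => by
    have := hv f x.1 x.2 hf
    rwa [smul_var] at this

theorem hom_ext {φ ψ : DifferencePolynomial G ι A →+*[G] B}
    (hc : ∀ a, φ (const G ι A a) = ψ (const G ι A a))
    (hv : ∀ i, φ (var G A i) = ψ (var G A i)) (f : DifferencePolynomial G ι A) : φ f = ψ f := by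
  induction f using induction_on with
  | hc a => exact hc a
  | ha f h hf hh => rw [map_add, map_add, hf, hh]
  | hv f g i hf => rw [map_mul, map_mul, hf, map_smul, map_smul, hv]

/-- The difference homomorphism that is `φ` on the coefficients and sends `y_i` to `x i`. -/
noncomputable def lift (φ : A →+*[G] B) (x : ι → B) : DifferencePolynomial G ι A →+*[G] B where
  __ := (MvPolynomial.eval₂Hom (φ : A →+* B) (fun p : G × ι => p.1 • x p.2) :
    MvPolynomial (G × ι) A →+* B)
  map_smul' g f := by
    have key : (MvPolynomial.eval₂Hom (φ : A →+* B) (fun p : G × ι => p.1 • x p.2)).comp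
        (shift G ι g) = (MulSemiringAction.toRingHom G B g).comp
          (MvPolynomial.eval₂Hom (φ : A →+* B) (fun p : G × ι => p.1 • x p.2)) := by
      refine MvPolynomial.ringHom_ext (fun a => ?_) fun p => ?_
      · simp [shift, map_smul]
      · simp [shift, mul_smul]
    exact RingHom.congr_fun key f

@[simp]
theorem lift_const (φ : A →+*[G] B) (x : ι → B) (a : A) : lift φ x (const G ι A a) = φ a :=
  MvPolynomial.eval₂Hom_C (φ : A →+* B) (fun p : G × ι => p.1 • x p.2) a

@[simp]
theorem lift_var (φ : A →+*[G] B) (x : ι → B) (i : ι) : lift φ x (var G A i) = x i := by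
  refine (MvPolynomial.eval₂Hom_X' (φ : A →+* B) (fun p : G × ι => p.1 • x p.2) (1, i)).trans ?_
  exact one_smul G (x i)

theorem eval_eq_lift (x : ι → A) (f : DifferencePolynomial G ι A) :
    eval x f = lift (MulSemiringActionHom.id G) x f :=
  rfl

variable (G A) in
/-- Renaming of the indeterminates. -/
noncomputable def rename (e : ι → κ) :
    DifferencePolynomial G ι A →+*[G] DifferencePolynomial G κ A :=
  lift (const G κ A) fun i => var G A (e i)

theorem map_lift {D : Type*} [CommRing D] [MulSemiringAction G D] (ψ : B →+*[G] D)
    (φ : A →+*[G] B) (x : ι → B) (f : DifferencePolynomial G ι A) :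
    ψ (lift φ x f) = lift (ψ.comp φ) (fun i => ψ (x i)) f :=
  hom_ext (φ := ψ.comp (lift φ x)) (by simp) (by simp) f

@[simp]
theorem lift_rename (φ : A →+*[G] B) (e : ι → κ) (x : κ → B) (f : DifferencePolynomial G ι A) :
    lift φ x (rename G A e f) = lift φ (fun i => x (e i)) f :=
  hom_ext (φ := (lift φ x).comp (rename G A e)) (by simp [rename]) (by simp [rename]) f

/-- A difference polynomial involves finitely many of the indeterminates `Y`, so it comes from one
in which they are replaced by a countable set of indeterminates. -/
theorem exists_rename_eq [Nonempty ι] (f : DifferencePolynomial G (ι ⊕ κ) A) :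
    ∃ (a : ℕ → ι) (p : DifferencePolynomial G (ℕ ⊕ κ) A), rename G A (Sum.map a id) p = f := by
  suffices H : ∃ s : Set ι, s.Finite ∧ ∀ a : ℕ → ι, s ⊆ Set.range a →
      ∃ p : DifferencePolynomial G (ℕ ⊕ κ) A, rename G A (Sum.map a id) p = f by
    obtain ⟨s, hs, h⟩ := H
    let j := Classical.arbitrary ι
    obtain ⟨a, ha⟩ := (hs.insert j).countable.exists_eq_range (Set.insert_nonempty j s)
    exact ⟨a, h a (ha ▸ Set.subset_insert j s)⟩
  induction f using induction_on with
  | hc a => exact ⟨∅, Set.finite_empty, fun e _ => ⟨const G _ A a, by simp [rename]⟩⟩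
  | ha f h hf hh =>
    obtain ⟨s, hs, hf⟩ := hf
    obtain ⟨t, ht, hh⟩ := hh
    refine ⟨s ∪ t, hs.union ht, fun a ha => ?_⟩
    obtain ⟨p, rfl⟩ := hf a (Set.subset_union_left.trans ha)
    obtain ⟨q, rfl⟩ := hh a (Set.subset_union_right.trans ha)
    exact ⟨p + q, map_add _ _ _⟩
  | hv f g i hf =>
    obtain ⟨s, hs, hf⟩ := hf
    cases i with
    | inl i =>
      refine ⟨insert i s, hs.insert i, fun a ha => ?_⟩
      obtain ⟨p, rfl⟩ := hf a ((Set.subset_insert i s).trans ha)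
      obtain ⟨n, hn⟩ := ha (Set.mem_insert i s)
      refine ⟨p * g • var G A (Sum.inl n), ?_⟩
      rw [map_mul, map_smul]
      simp [rename, hn]
    | inr i =>
      refine ⟨s, hs, fun a ha => ?_⟩
      obtain ⟨p, rfl⟩ := hf a ha
      refine ⟨p * g • var G A (Sum.inr i), ?_⟩
      rw [map_mul, map_smul]
      simp [rename]

/-- Clearing of denominators. Let `L` be a field in which every element is a quotient of values of
difference polynomials over `K` at the family `c`. Then every difference polynomial over `L` is, up
to a nonzero factor of `L`, obtained from one over `K` by substitution of `c`. -/
theorem exists_lift_eq_const_mul {J K L : Type*} [Field K] [MulSemiringAction G K] [Field L]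
    [MulSemiringAction G L] (φ : K →+*[G] L) (c : J → L)
    (hL : ∀ x : L, ∃ a b, lift φ c b ≠ 0 ∧ x * lift φ c b = lift φ c a)
    (f : DifferencePolynomial G ι L) :
    ∃ (d : L) (p : DifferencePolynomial G (J ⊕ ι) K), d ≠ 0 ∧
      lift ((const G ι L).comp φ) (Sum.elim (fun j => const G ι L (c j)) (var G L)) p
        = const G ι L d * f := by
  have key : ∀ a : DifferencePolynomial G J K,
      lift ((const G ι L).comp φ) (Sum.elim (fun j => const G ι L (c j)) (var G L))
        (rename G K Sum.inl a) = const G ι L (lift φ c a) := fun a => by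
    rw [lift_rename, map_lift]
    rfl
  induction f using induction_on with
  | hc x =>
    obtain ⟨a, b, hb, hab⟩ := hL x
    refine ⟨lift φ c b, rename G K Sum.inl a, hb, ?_⟩
    rw [key, ← hab, map_mul, mul_comm]
  | ha f h hf hh =>
    obtain ⟨d, p, hd, hp⟩ := hf
    obtain ⟨e, q, he, hq⟩ := hh
    obtain ⟨a, b, hb, hab⟩ := hL d
    obtain ⟨a', b', hb', hab'⟩ := hL e
    -- `d = a / b` and `e = a' / b'`, so `a a' = d (b a') = e (b' a)`, where the cofactors `b a'` and
    -- `b' a` are values of difference polynomials over `K`.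
    refine ⟨lift φ c a * lift φ c a', rename G K Sum.inl (b * a') * p
      + rename G K Sum.inl (b' * a) * q, ?_, ?_⟩
    · rw [← hab, ← hab']
      exact mul_ne_zero (mul_ne_zero hd hb) (mul_ne_zero he hb')
    · simp only [map_add, map_mul, key, hp, hq, ← hab, ← hab']
      ring
  | hv f g i hf =>
    obtain ⟨d, p, hd, hp⟩ := hf
    refine ⟨d, p * g • var G K (Sum.inr i), hd, ?_⟩
    rw [map_mul, map_smul, hp]
    simp [mul_assoc]

end DifferencePolynomial

/-- By Hilbert's basis theorem, an ideal of a polynomial ring over a Noetherian ring is generated by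
a countable set for every finite set of the indeterminates. What matters is that the index set of
the generators does not depend on the coefficient ring. -/
theorem MvPolynomial.exists_span_range_eq {σ k : Type*} [CommRing k] [IsNoetherianRing k]
    (I : Ideal (MvPolynomial σ k)) :
    ∃ f : Finset σ × ℕ → MvPolynomial σ k, Ideal.span (Set.range f) = I := by
  have H : ∀ s : Finset σ, ∃ f : ℕ → MvPolynomial s k,
      Ideal.span (Set.range f) = I.comap (MvPolynomial.rename (R := k) ((↑) : s → σ)) := by
    intro s
    obtain ⟨T, hT⟩ := IsNoetherian.noetherian
      (I.comap (MvPolynomial.rename (R := k) ((↑) : s → σ)))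
    obtain ⟨f, hf⟩ := (T.finite_toSet.insert 0).countable.exists_eq_range (Set.insert_nonempty 0 _)
    refine ⟨f, ?_⟩
    rw [← hf, ← hT]
    exact Submodule.span_insert_zero
  choose f hf using H
  refine ⟨fun b => MvPolynomial.rename (↑) (f b.1 b.2), le_antisymm ?_ fun p hp => ?_⟩
  · rw [Ideal.span_le]
    rintro _ ⟨⟨s, n⟩, rfl⟩
    have : f s n ∈ I.comap (MvPolynomial.rename (R := k) ((↑) : s → σ)) :=
      hf s ▸ Ideal.subset_span ⟨n, rfl⟩
    exact this
  · obtain ⟨s, q, rfl⟩ := MvPolynomial.exists_finset_rename p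
    have hq : q ∈ Ideal.span (Set.range (f s)) := by
      rw [hf s]
      exact hp
    have := Ideal.mem_map_of_mem (MvPolynomial.rename (R := k) ((↑) : s → σ)) hq
    rw [Ideal.map_span] at this
    refine Ideal.span_mono ?_ this
    rintro _ ⟨_, ⟨n, rfl⟩, rfl⟩
    exact ⟨(s, n), rfl⟩

/-! ### The residue field of an invariant prime ideal -/

/-- The field of fractions of `A / P` is a difference field. -/
theorem IsDifferenceIdeal.exists_fractionField {G : Type*} {A : Type w} [Group G] [CommRing A]
    [MulSemiringAction G A] {P : Ideal A} (hP : P.IsPrime) (hG : IsDifferenceIdeal G P) :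
    ∃ (L : Type w) (_ : Field L) (_ : MulSemiringAction G L) (φ : A →+*[G] L),
      (∀ a, φ a = 0 ↔ a ∈ P) ∧ ∀ x, ∃ a b, φ b ≠ 0 ∧ x * φ b = φ a := by
  let L := FractionRing (A ⧸ P)
  let π : A →+* L := (algebraMap (A ⧸ P) L).comp (Ideal.Quotient.mk P)
  have hπ : ∀ a, π a = 0 ↔ a ∈ P := fun a => by
    rw [RingHom.comp_apply, FaithfulSMul.algebraMap_eq_zero_iff, Ideal.Quotient.eq_zero_iff_mem]
  have hfrac : ∀ x, ∃ a b, π b ≠ 0 ∧ x * π b = π a := by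
    intro x
    obtain ⟨a, b, hb, rfl⟩ := IsFractionRing.div_surjective (A := A ⧸ P) x
    obtain ⟨a, rfl⟩ := Ideal.Quotient.mk_surjective a
    obtain ⟨b, rfl⟩ := Ideal.Quotient.mk_surjective b
    have hb' : π b ≠ 0 := fun h => nonZeroDivisors.ne_zero hb
      ((FaithfulSMul.algebraMap_eq_zero_iff (A ⧸ P) L).1 h)
    exact ⟨a, b, hb', div_mul_cancel₀ _ hb'⟩
  have hext : ∀ f h : L →+* L, (∀ a, f (π a) = h (π a)) → f = h := by
    intro f h hfh
    ext x
    obtain ⟨a, b, hb, hx⟩ := hfrac x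
    have e := congrArg f hx
    have e' := congrArg h hx
    rw [map_mul] at e e'
    refine mul_right_cancel₀ (b := f (π b)) (by simpa using hb) ?_
    rw [e, hfh, hfh, e']
  have hact : ∀ g : G, ∃ τ : L →+* L, ∀ a, τ (π a) = π (g • a) := by
    intro g
    let ρ : A ⧸ P →+* L := Ideal.Quotient.lift P (π.comp (MulSemiringAction.toRingHom G A g))
      fun a ha => (hπ _).2 (hG g a ha)
    have hρ : Function.Injective ρ := by
      rw [injective_iff_map_eq_zero]
      intro a ha
      obtain ⟨a, rfl⟩ := Ideal.Quotient.mk_surjective a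
      have h1 : g • a ∈ P := (hπ _).1 ha
      have h2 := hG g⁻¹ _ h1
      rw [inv_smul_smul] at h2
      exact Ideal.Quotient.eq_zero_iff_mem.2 h2
    exact ⟨IsFractionRing.lift hρ, fun a => IsFractionRing.lift_algebraMap hρ _⟩
  choose τ hτ using hact
  let T : G →* (L →+* L) :=
    { toFun := τ
      map_one' := hext _ _ fun a => by 
        rw [hτ, one_smul, RingHom.one_def, RingHom.id_apply]
      map_mul' := fun g h => hext _ _ fun a => by
        change τ (g * h) (π a) = τ g (τ h (π a))
        rw [hτ (g * h), hτ h, hτ g, mul_smul] }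
  let : MulSemiringAction G L := MulSemiringAction.compHom L T
  exact ⟨L, inferInstance, inferInstance, { π with map_smul' := fun g a => (hτ g a).symm },
    hπ, hfrac⟩

/-! ### Systems of equations and their witnesses -/

section Witness

variable (G : Type u) (K : Type v) [Field K]

/-- The indeterminates of the ring from which the differencly closed field is made. Apart from the
indeterminate `base`, there is for every system of equations in `y_1, …, y_n` a tuple of witnesses
`wit S a 1, …, wit S a n`, the designated solution of the system. A system is a family of difference
polynomials over `K` that is indexed by `Finset (G × Fin n) × ℕ` and has other witnesses as
coefficients: the equation `b` is `S b` with the witness `a b k` in place of the indeterminate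
`inl k`. -/
inductive Witness : Type (max u v)
  | base : Witness
  | wit {n : ℕ} (S : Finset (G × Fin n) × ℕ → DifferencePolynomial G (ℕ ⊕ Fin n) K)
      (a : Finset (G × Fin n) × ℕ → ℕ → Witness) (i : Fin n) : Witness

/-- A system of equations; see `Witness`. -/
structure WitnessSystem : Type (max u v) where
  /-- the number of unknowns -/
  n : ℕ
  /-- the equations, with indeterminates in the place of the coefficients -/
  eqn : Finset (G × Fin n) × ℕ → DifferencePolynomial G (ℕ ⊕ Fin n) K
  /-- the coefficients -/
  coef : Finset (G × Fin n) × ℕ → ℕ → Witness G K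

namespace WitnessSystem

variable {G K}

/-- The designated solution of a system. -/
def sol (s : WitnessSystem G K) (i : Fin s.n) : Witness G K :=
  .wit s.eqn s.coef i

theorem sol_injective (s : WitnessSystem G K) : Function.Injective s.sol := fun i j h => by
  simpa [sol] using h

theorem eq_of_sol_eq {s t : WitnessSystem G K} {i : Fin s.n} {j : Fin t.n}
    (h : s.sol i = t.sol j) : s = t := by
  obtain ⟨n, S, a⟩ := s
  obtain ⟨m, T, b⟩ := t
  simp only [sol, Witness.wit.injEq] at h
  obtain ⟨rfl, h1, h2, -⟩ := h
  rw [eq_of_heq h1, eq_of_heq h2]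

/-- A system precedes another one if some unknown of the former is a coefficient of the latter. -/
def Precedes (s t : WitnessSystem G K) : Prop :=
  ∃ b k i, t.coef b k = s.sol i

theorem precedes_wellFounded : WellFounded (Precedes : WitnessSystem G K → _ → Prop) := by
  have H : ∀ (j : Witness G K) (s : WitnessSystem G K) (i : Fin s.n), j = s.sol i →
      Acc Precedes s := by
    intro j
    induction j with
    | base => intro s i h; cases h
    | wit S a i' ih =>
      intro s i h
      obtain rfl := eq_of_sol_eq (s := ⟨_, S, a⟩) (i := i') h
      exact ⟨_, fun t ⟨b, k, l, hl⟩ => ih b k t l hl⟩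
  exact ⟨fun s => ⟨_, fun t ⟨b, k, l, hl⟩ => H _ t l hl⟩⟩

/-- The equations of a system for its designated solution. -/
noncomputable def relations [Group G] [MulSemiringAction G K] (s : WitnessSystem G K) :
    Set (DifferencePolynomial G (Witness G K) K) :=
  Set.range fun b => DifferencePolynomial.rename G K (Sum.elim (s.coef b) s.sol) (s.eqn b)

end WitnessSystem

end Witness

/-! ### Existence of the differencly closed field -/

open DifferencePolynomial

/-- A field is differencly closed if it consists of quotients of values at a family of witnesses,
and if the witnesses satisfy the relations of a system as soon as the system has a solution in
some extension. -/
theorem isDifferenclyClosed_of_witness {G : Type u} [Group G] {K : Type v} [Field K]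
    [MulSemiringAction G K] {L : Type (max u v)} [Field L] [MulSemiringAction G L] (φ : K →+*[G] L)
    (c : Witness G K → L)
    (hL : ∀ x : L, ∃ a b, lift φ c b ≠ 0 ∧ x * lift φ c b = lift φ c a)
    (hc : ∀ (s : WitnessSystem G K) (E : Type (max u v)) (_ : Field E) (_ : MulSemiringAction G E)
      (ψ : L →+*[G] E) (ξ : Fin s.n → E),
      (∀ b, lift (ψ.comp φ) (Sum.elim (fun k => ψ (c (s.coef b k))) ξ) (s.eqn b) = 0) →
      ∀ f ∈ s.relations, lift φ c f = 0) :
    IsDifferenclyClosed G L := by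
  intro n I hI hne
  obtain ⟨Q, hQ, hQG, hIQ⟩ := hI.exists_le_prime hne
  obtain ⟨f, hf⟩ : ∃ f : Finset (G × Fin n) × ℕ → DifferencePolynomial G (Fin n) L,
    Ideal.span (Set.range f) = Q := MvPolynomial.exists_span_range_eq (σ := G × Fin n) (k := L) Q
  choose d p hd hp using fun b => exists_lift_eq_const_mul φ c hL (f b)
  have : Nonempty (Witness G K) := ⟨.base⟩
  choose a S hS using fun b => exists_rename_eq (p b)
  let s : WitnessSystem G K := ⟨n, S, a⟩
  obtain ⟨E, _, _, ψ, hψ, -⟩ := hQG.exists_fractionField hQ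
  -- The residue classes of the `y_i` form a solution of the system in the extension `E` of `L`.
  have hs := hc s E _ _ (ψ.comp (const G (Fin n) L)) (fun i => ψ (var G L i)) (fun b => by
    have h1 : ψ (lift ((const G (Fin n) L).comp φ)
        (Sum.elim (fun j => const G (Fin n) L (c j)) (var G L)) (p b)) = 0 := by
      rw [hp, hψ, ← hf]
      exact Ideal.mul_mem_left _ _ (Ideal.subset_span ⟨b, rfl⟩)
    rw [← hS, lift_rename, map_lift] at h1
    rw [← h1]
    congr 2
    funext k
    cases k <;> rfl)
  have hgen : ∀ b, eval (fun i => c (s.sol i)) (f b) = 0 := by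
    intro b
    have h1 := hs _ ⟨b, rfl⟩
    rw [lift_rename] at h1
    have h2 := congrArg (lift (MulSemiringActionHom.id G) fun i => c (s.sol i)) (hp b)
    rw [← hS, lift_rename, map_lift, map_mul, lift_const] at h2
    refine (mul_eq_zero.1 (h2.symm.trans (Eq.trans ?_ h1))).resolve_left (hd b)
    congr 2
    · ext x
      exact lift_const (ι := Fin n) (MulSemiringActionHom.id G : L →+*[G] L)
        (fun i => c (s.sol i)) (φ x)
    · funext k
      cases k <;> simp [s]
  refine ⟨fun i => c (s.sol i), fun h hh => ?_⟩
  have hker : Q ≤ RingHom.ker (eval (G := G) (fun i => c (s.sol i))) := by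
    rw [← hf, Ideal.span_le]
    rintro _ ⟨b, rfl⟩
    exact hgen b
  exact hker (hIQ hh)

theorem mainTheorem1 (G : Type u) [Group G] (K : Type v) [Field K] [MulSemiringAction G K] :
    ∃ (L : Type (max u v)) (_ : Field L) (_ : MulSemiringAction G L) (φ : K →+*[G] L),
      Function.Injective φ ∧ IsDifferenclyClosed G L := by
  classical
  have : IsWellFounded (WitnessSystem G K) WitnessSystem.Precedes :=
    ⟨WitnessSystem.precedes_wellFounded⟩
  obtain ⟨r, hr, _⟩ := IsWellFounded.exists_well_order_ge
    (WitnessSystem.Precedes : WitnessSystem G K → _ → Prop)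
  have h0 : IsConsistent G (∅ : Set (DifferencePolynomial G (Witness G K) K)) :=
    isConsistent_of_hom (lift (MulSemiringActionHom.id G) 0) (by simp)
  obtain ⟨T, ⟨I, hI, hne, hTI⟩, hT⟩ := exists_greedy_isConsistent h0 r WitnessSystem.relations
  obtain ⟨P, hP, hPG, hIP⟩ := hI.exists_le_prime hne
  obtain ⟨L, _, _, π, hπ, hfrac⟩ := hPG.exists_fractionField hP
  let φ : K →+*[G] L := π.comp (const G _ K)
  let c : Witness G K → L := fun j => π (var G K j)
  have hlift : ∀ f, π f = lift φ c f := hom_ext (by simp [φ]) (by simp [c])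
  have hmem : ∀ s ∈ T, ∀ f ∈ s.relations, lift φ c f = 0 := fun s hs f hf => by
    rw [← hlift, hπ]
    exact hIP (hTI (Set.mem_biUnion hs hf))
  refine ⟨L, _, _, φ, (φ : K →+* L).injective,
    isDifferenclyClosed_of_witness φ c (fun x => ?_) fun s E _ _ ψ ξ hξ => ?_⟩
  · obtain ⟨a, b, hb, hab⟩ := hfrac x
    exact ⟨a, b, by rwa [← hlift], by rwa [← hlift, ← hlift]⟩
  refine hmem s (hT s ?_)
  -- Redefine the values of the witnesses of `s` only: neither the relations of the earlier systems
  -- nor the coefficients of `s` involve these witnesses.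
  let θ : Witness G K → E := fun j =>
    if h : ∃ i, j = s.sol i then ξ h.choose else ψ (c j)
  have hθs : ∀ i, θ (s.sol i) = ξ i := fun i => by
    have h : ∃ i', s.sol i = s.sol i' := ⟨i, rfl⟩
    have h' : i = h.choose := s.sol_injective h.choose_spec
    change (if h : ∃ i', s.sol i = s.sol i' then ξ h.choose else ψ (c (s.sol i))) = ξ i
    rw [dif_pos h, ← h']
  have hθ : ∀ j, (∀ i, j ≠ s.sol i) → θ j = ψ (c j) := fun j hj => by
    exact dif_neg fun ⟨i, hi⟩ => hj i hi
  have hcoef : ∀ t, (t = s ∨ r t s) → ∀ b k, θ (t.coef b k) = ψ (c (t.coef b k)) := by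
    intro t ht b k
    refine hθ _ fun i hi => ?_
    have hst : r s t := hr _ _ ⟨b, k, i, hi⟩
    rcases ht with rfl | ht
    · exact irrefl_of r t hst
    · exact irrefl_of r s (trans_of r hst ht)
  refine isConsistent_of_hom (lift (ψ.comp φ) θ) ?_
  rintro f (⟨b, rfl⟩ | hf)
  · rw [lift_rename, ← hξ b]
    congr 2
    funext k
    cases k with
    | inl k => exact hcoef s (Or.inl rfl) b k
    | inr i => exact hθs i
  · obtain ⟨t, ⟨htT, hts⟩, b, rfl⟩ := Set.mem_iUnion₂.1 hf
    have h1 := congrArg ψ (hmem t htT _ ⟨b, rfl⟩)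
    rw [lift_rename, map_lift, map_zero] at h1
    rw [lift_rename, ← h1]
    congr 2
    funext k
    cases k with
    | inl k => exact hcoef t (Or.inr hts) b k
    | inr i =>
      refine hθ _ fun i' h => ?_
      obtain rfl := WitnessSystem.eq_of_sol_eq h
      exact irrefl_of r t hts
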